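/- There exists a universal constant $C>0$ such that the following holds. Let $d\ge 0$ and $1\le K\le N$ be integers, let $\|\cdot\|$ be any norm on $\mathbb{R}^d$ with dual norm $\|u\|_*=\sup_{\|x\|\le 1}\langle x,u\rangle$, let $\mathcal{B}^*$ be the unit ball of $\|\cdot\|_*$ and $\mathcal{B}^*_0$ the set of its extreme points. For a $d\times d$ matrix $A$ put $|||A|||=\sup_{u\in\mathcal{B}^*}\|Au\|_2$. Let $\mathrm{VC}(\mathcal{B}^*_0)$ be the VC-dimension of the set of Boolean functions $x\mapsto \mathbf{1}_{\langle x,v\rangle\ge 0}$ on $\mathbb{R}^d$, $v\in\mathcal{B}^*_0$, i.e. the largest cardinality of a finite set $S\subset\mathbb{R}^d$ such that every subset of $S$ is of the form $\{x\in S:\langle x,v\rangle\ge 0\}$ for some $v\in\mathcal{B}^*_0$. Let $Y_1,\dots,Y_N$ be i.i.d. random vectors in $\mathbb{R}^d$ with finite second moment, mean $\mu$ and covariance matrix $\Sigma$. One observes $X_1,\dots,X_N$, where $X_i=Y_i$ for all $i\notin\mathcal{O}$ and $\mathcal{O}\subset\{1,\dots,N\}$ is a possibly random set; nothing else is assumed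 about $\mathcal{O}$ and $(X_i)_{i\in\mathcal{O}}$, which may depend arbitrarily on all the other variables. Let $B_1,\dots,B_K$ be disjoint subsets of $\{1,\dots,N\}$ of equal size $m=\lfloor N/K\rfloor$, deterministic or chosen at random independently of $(Y_i)_{i\le N}$. Let $\bar X_k=\frac1m\sum_{i\in B_k}X_i$, and let $$\hat\mu_K\in\operatorname*{argmin}_{a\in\mathbb{R}^d}\ \sup_{u\in\mathcal{B}^*_0}\ \mathrm{Med}_{1\le k\le K}\,\langle \bar X_k-a,u\rangle$$ be any minimizer, where $\mathrm{Med}$ is the median (the average of the two middle values when $K$ is even). If $K\ge C\,(\mathrm{VC}(\mathcal{B}^*_0)\vee|\mathcal{O}|)$ almost surely, then, with probability at least $1-\exp(-K/128)$, $$\|\hat\mu_K-\mu\|\le 8\,|||\Sigma^{1/2}|||\,\sqrt{\frac{K}{N}}.$$ -/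

import Mathlib

open MeasureTheory ProbabilityTheory

noncomputable section

namespace MOM

/-- `ℝ^d` with its Euclidean structure. -/
abbrev Vec (d : ℕ) := EuclideanSpace ℝ (Fin d)

/-! ### VC-dimension -/

/-- A finite set `S` is shattered by a family `F` of Boolean functions (predicates) if every
subset `B` of `S` is of the form `S ∩ {f true}` with `f ∈ F`. -/
def Shatters {X : Type*} (F : Set (X → Prop)) (S : Finset X) : Prop :=
  ∀ B ⊆ S, ∃ f ∈ F, ∀ x ∈ S, f x ↔ x ∈ B

/-- The VC-dimension of a family of Boolean functions: the supremum in `ℕ∞` of the cardinalities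
of the finite sets it shatters. -/
def vcDim {X : Type*} (F : Set (X → Prop)) : ℕ∞ :=
  ⨆ S : {S : Finset X // Shatters F S}, (S.1.card : ℕ∞)

/-- The indicators of the half-spaces `{x | ⟨x, v⟩ ≥ 0}` for `v ∈ C`. -/
def halfSpaces {d : ℕ} (C : Set (Vec d)) : Set (Vec d → Prop) :=
  {f | ∃ v ∈ C, f = fun x => 0 ≤ inner ℝ x v}

/-- The VC-dimension of a set of vectors. -/
def vcDimVec {d : ℕ} (C : Set (Vec d)) : ℕ∞ := vcDim (halfSpaces C)

/-! ### Norms on `ℝ^d` -/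

/-- The norm dual to `p`: `‖u‖_* = sup {⟨x, u⟩ | p x ≤ 1}`. -/
def dualNorm {d : ℕ} (p : Seminorm ℝ (Vec d)) (u : Vec d) : ℝ :=
  sSup {t | ∃ x : Vec d, p x ≤ 1 ∧ t = inner ℝ x u}

/-- The closed unit ball `B*` of the dual norm. -/
def dualBall {d : ℕ} (p : Seminorm ℝ (Vec d)) : Set (Vec d) := {u | dualNorm p u ≤ 1}

/-- The set `B*_0` of extreme points of `B*`. -/
def dualExtreme {d : ℕ} (p : Seminorm ℝ (Vec d)) : Set (Vec d) :=
  (dualBall p).extremePoints ℝ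

/-- `|||A||| = sup {‖A u‖₂ | u ∈ B*}`. -/
def tripleNorm {d : ℕ} (p : Seminorm ℝ (Vec d)) (A : Matrix (Fin d) (Fin d) ℝ) : ℝ :=
  sSup ((fun u : Vec d => ‖Matrix.toEuclideanCLM (𝕜 := ℝ) A u‖) '' dualBall p)

/-! ### Mean and covariance -/

/-- The mean of a distribution on `ℝ^d`. -/
def mean {d : ℕ} (ν : Measure (Vec d)) : Vec d := ∫ x, x ∂ν

/-- The covariance matrix of a distribution on `ℝ^d`. -/
def covMat {d : ℕ} (ν : Measure (Vec d)) : Matrix (Fin d) (Fin d) ℝ :=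
  Matrix.of fun i j => ∫ x, (x i - mean ν i) * (x j - mean ν j) ∂ν

open scoped MatrixOrder in
/-- The positive semidefinite square root of the covariance matrix. -/
def sqrtCov {d : ℕ} (ν : Measure (Vec d)) : Matrix (Fin d) (Fin d) ℝ := CFC.sqrt (covMat ν)

/-! ### Median of means -/

/-- The median of `K` real numbers: the middle one in increasing order when `K` is odd, the average
of the two middle ones when `K` is even (`0` if `K = 0`). -/
def median {K : ℕ} (x : Fin K → ℝ) : ℝ :=
  if h : 0 < K then
    ((x ∘ Tuple.sort x) ⟨(K - 1) / 2, by omega⟩ + (x ∘ Tuple.sort x) ⟨K / 2, by omega⟩) / 2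
  else 0

/-- A choice of `K` pairwise disjoint blocks of indices among `N`, of the same size `⌊N / K⌋`
(the remaining indices are discarded). -/
structure BlockSplit (N K : ℕ) where
  block : Fin K → Finset (Fin N)
  card_block : ∀ k, (block k).card = N / K
  disjoint : ∀ k l, k ≠ l → Disjoint (block k) (block l)

/-- There are finitely many splits; all sets of splits are measurable. -/
instance (N K : ℕ) : MeasurableSpace (BlockSplit N K) := ⊤

/-- The empirical mean of `x` over the `k`-th block. -/
def blockMean {d N K : ℕ} (S : BlockSplit N K) (x : Fin N → Vec d) (k : Fin K) : Vec d :=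
  ((N / K : ℕ) : ℝ)⁻¹ • ∑ i ∈ S.block k, x i

/-- The criterion `a ↦ sup {Med_k ⟨x̄_k - a, u⟩ | u ∈ B*_0}`. -/
def criterion {d N K : ℕ} (p : Seminorm ℝ (Vec d)) (S : BlockSplit N K) (x : Fin N → Vec d)
    (a : Vec d) : ℝ :=
  sSup ((fun u : Vec d => median fun k => inner ℝ (blockMean S x k - a) u) '' dualExtreme p)

/-- `a` is a value of the min-max median-of-means estimator, i.e. a global minimizer of the
criterion. -/
def IsMomEstimate {d N K : ℕ} (p : Seminorm ℝ (Vec d)) (S : BlockSplit N K) (x : Fin N → Vec d)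
    (a : Vec d) : Prop :=
  ∀ b : Vec d, criterion p S x a ≤ criterion p S x b

end MOM

end

namespace MOM

/-! ### Combinatorics of half-spaces -/

/-! Let `s` be `tripleNorm p (sqrtCov ν)`, `r = 4 * s * √(K / N)`, and let `exceed` count the block
means whose centred projection on `u` is above `r`. If for every extreme `u` fewer than about half
the blocks exceed, the criterion at the mean `μ` is at most `r`, hence so is the criterion at the
minimizer `a`. As the extreme points are symmetric, the median at `a` in direction `u` is at least
`⟨μ - a, u⟩ - r`, so `⟨μ - a, u⟩ ≤ 2r`. Hahn-Banach and Krein-Milman turn this into `p (a - μ) ≤ 2r`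
(`seminorm_sub_le_of_exceed`). Outliers spoil at most `|O|` blocks (`exceed_blockMean_le`).

It remains to bound the exceedances uniformly in `u` for clean data. Chebyshev gives each block
probability at most 1/8 (`measureReal_inner_blockMean_le`). The Vapnik-Chervonenkis double-sample
argument (`measureReal_exists_exceed_le`) makes this uniform: compare with a ghost sample, exchange
blocks at random, apply Hoeffding to each trace of a half-space on the `2K` block means, and count
traces by Sauer's lemma (`card_traces_le`). Hoeffding yields `exp (-9K/512)`, the traces cost `exp
(3K/512)`, and the product is below `exp (-K/128)`. -/

theorem le_vcDimVec_of_forall {d n : ℕ} {C : Set (Vec d)} (y : Fin n → Vec d)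
    (h : ∀ b : Finset (Fin n), ∃ v ∈ C, ∀ i, 0 ≤ inner ℝ (y i) v ↔ i ∈ b) :
    (n : ℕ∞) ≤ vcDimVec C := by
  classical
  -- Distinctness of the points is automatic: the half-space selecting `i` alone separates it from
  -- the others.
  have hy : Function.Injective y := by
    intro i j hij
    obtain ⟨v, -, hv⟩ := h {i}
    have := (hv j).1 (hij ▸ (hv i).2 (by simp))
    exact (Finset.mem_singleton.1 this).symm
  have hS : Shatters (halfSpaces C) (Finset.univ.image y) := by
    intro B _
    obtain ⟨v, hvC, hv⟩ := h (Finset.univ.filter fun i => y i ∈ B)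
    refine ⟨_, ⟨v, hvC, rfl⟩, fun x hx => ?_⟩
    obtain ⟨i, -, rfl⟩ := Finset.mem_image.1 hx
    simpa using hv i
  have hcard : (Finset.univ.image y).card = n := by
    rw [Finset.card_image_of_injective _ hy]; simp
  have := le_iSup (fun S : {S : Finset (Vec d) // Shatters (halfSpaces C) S} => (S.1.card : ℕ∞))
    ⟨_, hS⟩
  rw [hcard] at this
  exact this

open Classical in
/-- The traces on the points `w i` of the half-spaces `{x | r < ⟨x, u⟩}`, `u ∈ C`. -/
noncomputable def traces {d : ℕ} {ι : Type*} [Fintype ι] (C : Set (Vec d)) (r : ℝ) (w : ι → Vec d) :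
    Finset (Finset ι) :=
  Finset.univ.filter fun s => ∃ u ∈ C, ∀ i, i ∈ s ↔ r < inner ℝ (w i) u

open Classical in
-- The threshold `r` is removed by pairing: if `2V + 2` points were shattered, group them in `V + 1`
-- pairs and put exactly one point of each pair above `r`. The sign of `⟨·, u⟩` on the difference of
-- the pair then records the choice, so the `V + 1` differences are shattered by homogeneous
-- half-spaces.
theorem vcDim_traces_le {d : ℕ} {ι : Type*} [Fintype ι] {C : Set (Vec d)} {V : ℕ}
    (hV : vcDimVec C ≤ V) (r : ℝ) (w : ι → Vec d) :
    (traces C r w).vcDim ≤ 2 * V + 1 := by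
  refine Finset.sup_le fun T hT => ?_
  rw [Finset.mem_shatterer] at hT
  by_contra! hlt
  let e := T.equivFin.symm
  -- Out-of-range indices get a default value in `T`, so that `f n ∈ T` for every `n`; injectivity
  -- is only used below `T.card`.
  let f : ℕ → ι := fun n => if h : n < T.card then e ⟨n, h⟩ else e ⟨0, by omega⟩
  have hfT : ∀ n, f n ∈ T := fun n => by
    simp only [f]; split_ifs <;> exact Subtype.property _
  have hinj : ∀ a b, a < T.card → b < T.card → f a = f b → a = b := by
    intro a b ha hb hab
    simp only [f, ha, hb, dif_pos] at hab
    have := e.injective (Subtype.ext hab)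
    simpa using this
  have key := le_vcDimVec_of_forall (C := C) (n := V + 1)
    (fun i => w (f (2 * i)) - w (f (2 * i + 1))) ?_
  · have : ((V + 1 : ℕ) : ℕ∞) ≤ (V : ℕ∞) := key.trans hV
    have := Nat.cast_le.1 this
    omega
  intro b
  let g : Fin (V + 1) → ι := fun i => if i ∈ b then f (2 * i) else f (2 * i + 1)
  obtain ⟨s, hs, hst⟩ := hT (t := Finset.univ.image g) (by
    intro x hx
    obtain ⟨i, -, rfl⟩ := Finset.mem_image.1 hx
    simp only [g]; split_ifs <;> exact hfT _)
  obtain ⟨u, hu, hus⟩ := (Finset.mem_filter.1 hs).2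
  have hmem : ∀ n, (∃ i, g i = f n) ↔ r < inner ℝ (w (f n)) u := by
    intro n
    rw [← hus]
    have := congrArg (fun t => f n ∈ t) hst
    simp only [Finset.mem_inter, hfT, true_and, Finset.mem_image, Finset.mem_univ] at this
    exact (Iff.of_eq this).symm
  refine ⟨u, hu, fun i => ?_⟩
  rw [inner_sub_left]
  have hi := i.2
  by_cases hib : i ∈ b
  · have h1 := (hmem (2 * i)).1 ⟨i, by simp [g, hib]⟩
    have h2 : ¬ r < inner ℝ (w (f (2 * i + 1))) u := by
      rw [← hmem]
      rintro ⟨j, hj⟩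
      have hj' := j.2
      by_cases hjb : j ∈ b
      · simp only [g, hjb, if_true] at hj
        have := hinj _ _ (by omega) (by omega) hj
        omega
      · simp only [g, hjb, if_false] at hj
        have := hinj _ _ (by omega) (by omega) hj
        exact hjb (by rwa [show j = i from Fin.ext (by omega)])
    simp only [hib, iff_true]
    linarith
  · have h1 := (hmem (2 * i + 1)).1 ⟨i, by simp [g, hib]⟩
    have h2 : ¬ r < inner ℝ (w (f (2 * i))) u := by
      rw [← hmem]
      rintro ⟨j, hj⟩
      have hj' := j.2
      by_cases hjb : j ∈ b
      · simp only [g, hjb, if_true] at hj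
        have := hinj _ _ (by omega) (by omega) hj
        exact hib (by rwa [show i = j from Fin.ext (by omega)])
      · simp only [g, hjb, if_false] at hj
        have := hinj _ _ (by omega) (by omega) hj
        omega
    simp only [hib, iff_false]
    linarith

/-- Exponential weighting: `x ^ (k - D) ≥ 1` for `k ≤ D`, and the binomial formula sums the weighted
terms. -/
theorem sum_choose_le_rpow (n D : ℕ) {x : ℝ} (hx : 0 < x) (hx1 : x ≤ 1) :
    ((∑ k ∈ Finset.Iic D, n.choose k : ℕ) : ℝ) ≤ (x⁻¹) ^ D * (1 + x) ^ n := by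
  have hx1' : 1 ≤ x⁻¹ := (one_le_inv₀ hx).2 hx1
  have h1 : ∀ k ∈ Finset.Iic D, (n.choose k : ℝ) ≤ x⁻¹ ^ D * (x ^ k * n.choose k) := by
    intro k hk
    have hk := Finset.mem_Iic.1 hk
    have : 1 ≤ x⁻¹ ^ D * x ^ k := by
      calc (1 : ℝ) = x⁻¹ ^ k * x ^ k := by rw [← mul_pow, inv_mul_cancel₀ hx.ne', one_pow]
        _ ≤ _ := by gcongr
    rw [← mul_assoc]
    exact le_mul_of_one_le_left (by positivity) this
  have h2 : ∑ k ∈ Finset.Iic D, x ^ k * (n.choose k : ℝ) ≤ (1 + x) ^ n := by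
    rw [add_comm, add_pow]
    simp only [one_pow, mul_one]
    by_cases hDn : D ≤ n
    · exact Finset.sum_le_sum_of_subset_of_nonneg
        (fun k hk => by simp at hk ⊢; omega) (fun _ _ _ => by positivity)
    · apply le_of_eq
      symm
      apply Finset.sum_subset (fun k hk => by simp at hk ⊢; omega)
      intro k _ hk
      simp at hk
      simp [Nat.choose_eq_zero_of_lt (show n < k by omega)]
  push_cast
  calc ∑ k ∈ Finset.Iic D, (n.choose k : ℝ) ≤ ∑ k ∈ Finset.Iic D, x⁻¹ ^ D * (x ^ k * n.choose k) :=
        Finset.sum_le_sum h1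
    _ = x⁻¹ ^ D * ∑ k ∈ Finset.Iic D, x ^ k * (n.choose k : ℝ) := by rw [Finset.mul_sum]
    _ ≤ _ := by gcongr

/-- Sauer's bound in a form adapted to families whose VC-dimension is a small fraction of `K`. -/
theorem card_traces_le {d K : ℕ} {C : Set (Vec d)} {V : ℕ} (hV : vcDimVec C ≤ V) (hV1 : 1 ≤ V)
    (hVK : 16384 * V ≤ K) (r : ℝ) (w : Fin K × Bool → Vec d) :
    2 * ((traces C r w).card : ℝ) ≤ Real.exp (3 * K / 512) := by
  classical
  have h1 : (traces C r w).card ≤ ∑ k ∈ Finset.Iic (3 * V), (2 * K).choose k := by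
    refine (Finset.card_le_card_shatterer _).trans (Finset.card_shatterer_le_sum_vcDim.trans ?_)
    have : Fintype.card (Fin K × Bool) = 2 * K := by simp [mul_comm]
    rw [this]
    apply Finset.sum_le_sum_of_subset
    apply Finset.Iic_subset_Iic.2
    have : (traces C r w).vcDim ≤ 2 * V + 1 := by convert vcDim_traces_le hV r w
    omega
  -- With `x = 1/1024` the two factors are at most `exp (30 V)` and `exp (K/512)`, and `30 * 512 ≤
  -- 16384` makes the first at most `exp (K/512)` too. The degree `3V` replaces `2V + 1` because `1
  -- ≤ V`.
  have h2 := sum_choose_le_rpow (2 * K) (3 * V) (x := 1 / 1024) (by norm_num) (by norm_num)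
  have h3 : ((1 / 1024 : ℝ)⁻¹) ^ (3 * V) ≤ Real.exp (K / 512) := by
    have h10 : (1024 : ℝ) ≤ Real.exp 10 := by
      have : (2 : ℝ) ≤ Real.exp 1 := by linarith [Real.add_one_le_exp 1]
      calc (1024 : ℝ) = 2 ^ 10 := by norm_num
        _ ≤ Real.exp 1 ^ 10 := by gcongr
        _ = Real.exp 10 := by rw [← Real.exp_nat_mul]; norm_num
    calc ((1 / 1024 : ℝ)⁻¹) ^ (3 * V) = 1024 ^ (3 * V) := by norm_num
      _ ≤ Real.exp 10 ^ (3 * V) := by gcongr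
      _ = Real.exp ((3 * V : ℕ) * 10) := by rw [← Real.exp_nat_mul]
      _ ≤ _ := by
        apply Real.exp_le_exp.2
        have : (16384 * V : ℝ) ≤ K := by exact_mod_cast hVK
        push_cast
        linarith [Nat.cast_nonneg (α := ℝ) V]
  have h4 : (1 + 1 / 1024 : ℝ) ^ (2 * K) ≤ Real.exp (K / 512) := by
    calc (1 + 1 / 1024 : ℝ) ^ (2 * K) ≤ Real.exp (1 / 1024) ^ (2 * K) := by
          gcongr; linarith [Real.add_one_le_exp (1 / 1024 : ℝ)]
      _ = Real.exp (K / 512) := by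
          rw [← Real.exp_nat_mul]; congr 1; push_cast; ring
  have h5 : (2 : ℝ) ≤ Real.exp (K / 512) := by
    have : (16384 * V : ℝ) ≤ K := by exact_mod_cast hVK
    have hV' : (1 : ℝ) ≤ V := by exact_mod_cast hV1
    linarith [Real.add_one_le_exp (K / 512 : ℝ)]
  have h1' : ((traces C r w).card : ℝ) ≤ ((∑ k ∈ Finset.Iic (3 * V), (2 * K).choose k : ℕ) : ℝ) := by
    exact_mod_cast h1
  calc 2 * ((traces C r w).card : ℝ) ≤
      Real.exp (K / 512) * (Real.exp (K / 512) * Real.exp (K / 512)) := by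
        gcongr
        exact h1'.trans (h2.trans (by gcongr))
    _ = _ := by rw [← Real.exp_add, ← Real.exp_add]; congr 1; ring

/-- Hoeffding's inequality for Rademacher sums, in counting form. -/
theorem card_signs_le {K : ℕ} (hK : 0 < K) (a : Fin K → ℝ) (ha : ∀ k, |a k| ≤ 1) {t : ℝ}
    (ht : 0 ≤ t) :
    ((Finset.univ.filter fun σ : Fin K → Bool => t ≤ ∑ k, if σ k then -a k else a k).card : ℝ) ≤
      2 ^ K * Real.exp (-t ^ 2 / (2 * K)) := by
  have hK' : (0 : ℝ) < K := by exact_mod_cast hK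
  -- This value minimizes the Chernoff exponent `K l² / 2 - l t`.
  set l : ℝ := t / K with hl
  have hl0 : 0 ≤ l := by positivity
  have hprod : ∑ σ : Fin K → Bool, Real.exp (l * ∑ k, if σ k then -a k else a k) ≤
      2 ^ K * Real.exp (K * (l ^ 2 / 2)) := by
    calc ∑ σ : Fin K → Bool, Real.exp (l * ∑ k, if σ k then -a k else a k)
        = ∑ σ : Fin K → Bool, ∏ k, Real.exp (l * if σ k then -a k else a k) := by
          simp_rw [Finset.mul_sum, Real.exp_sum]
      _ = ∏ k, ∑ b : Bool, Real.exp (l * if b then -a k else a k) := by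
          rw [Finset.prod_univ_sum, Fintype.piFinset_univ]
      _ = ∏ k, (2 * Real.cosh (l * a k)) := by
          refine Finset.prod_congr rfl fun k _ => ?_
          rw [Fintype.sum_bool, Real.cosh_eq]
          simp only [if_true, Bool.false_eq_true, if_false, mul_neg]
          ring
      _ ≤ ∏ _k : Fin K, (2 * Real.exp (l ^ 2 / 2)) := by
          refine Finset.prod_le_prod (fun k _ => by positivity) fun k _ => ?_
          refine mul_le_mul_of_nonneg_left ((Real.cosh_le_exp_half_sq _).trans ?_) (by norm_num)
          apply Real.exp_le_exp.2
          have : (a k) ^ 2 ≤ 1 := by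
            rw [← sq_abs]; exact pow_le_one₀ (abs_nonneg _) (ha k)
          rw [mul_pow]
          have := mul_le_of_le_one_right (sq_nonneg l) this
          linarith
      _ = _ := by
          rw [Finset.prod_const, mul_pow, ← Real.exp_nat_mul]; simp
  have hcount : ((Finset.univ.filter fun σ : Fin K → Bool =>
      t ≤ ∑ k, if σ k then -a k else a k).card : ℝ) * Real.exp (l * t) ≤
      ∑ σ : Fin K → Bool, Real.exp (l * ∑ k, if σ k then -a k else a k) := by
    rw [← nsmul_eq_mul]
    refine (Finset.card_nsmul_le_sum _ _ _ fun σ hσ => ?_).trans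
      (Finset.sum_le_sum_of_subset_of_nonneg (Finset.filter_subset _ _)
        fun _ _ _ => (Real.exp_pos _).le)
    exact Real.exp_le_exp.2 (mul_le_mul_of_nonneg_left (Finset.mem_filter.1 hσ).2 hl0)
  have h := hcount.trans hprod
  rw [← le_div_iff₀ (Real.exp_pos _), mul_div_assoc, ← Real.exp_sub] at h
  refine h.trans (le_of_eq ?_)
  congr 2
  rw [hl]
  field_simp
  ring

end MOM

namespace MOM

/-! ### Symmetrization -/

open Classical in
/-- The number of indices `k` with `r < ⟨x k, u⟩`. -/
noncomputable def exceed {d K : ℕ} (r : ℝ) (u : Vec d) (x : Fin K → Vec d) : ℕ :=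
  (Finset.univ.filter fun k => r < inner ℝ (x k) u).card

open Classical in
theorem exceed_eq_sum {d K : ℕ} (r : ℝ) (u : Vec d) (x : Fin K → Vec d) :
    (exceed r u x : ℝ) = ∑ k, if r < inner ℝ (x k) u then (1 : ℝ) else 0 := by
  simp [exceed]

theorem measurable_exceed {d K : ℕ} (r : ℝ) (u : Vec d) :
    Measurable fun x : Fin K → Vec d => (exceed r u x : ℝ) := by
  classical
  simp_rw [exceed_eq_sum]
  refine Finset.measurable_sum _ fun k _ => ?_
  refine Measurable.ite ?_ measurable_const measurable_const
  exact measurableSet_lt measurable_const (by fun_prop)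

/-- With both samples fixed, the difference of counts depends on `u` only through the trace of its
half-space on the `2K` points. A union bound over traces leaves Rademacher sums with coefficients in
`{-1, 0, 1}`. -/
theorem card_swaps_le {d K : ℕ} (hK : 0 < K) (C : Set (Vec d)) (r t : ℝ) (ht : 0 ≤ t)
    (x y : Fin K → Vec d) [DecidablePred fun σ : Fin K → Bool => ∃ u ∈ C,
      t ≤ (exceed r u fun k => if σ k then y k else x k) -
        (exceed r u fun k => if σ k then x k else y k : ℝ)] :
    ((Finset.univ.filter fun σ : Fin K → Bool => ∃ u ∈ C,
      t ≤ (exceed r u fun k => if σ k then y k else x k) -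
        (exceed r u fun k => if σ k then x k else y k : ℝ)).card : ℝ) ≤
      (traces C r fun j : Fin K × Bool => if j.2 then y j.1 else x j.1).card *
        (2 ^ K * Real.exp (-t ^ 2 / (2 * K))) := by
  classical
  set w : Fin K × Bool → Vec d := fun j => if j.2 then y j.1 else x j.1 with hw
  let a : Finset (Fin K × Bool) → Fin K → ℝ := fun s k =>
    (if (k, false) ∈ s then 1 else 0) - (if (k, true) ∈ s then 1 else 0)
  have hsub : (Finset.univ.filter fun σ : Fin K → Bool => ∃ u ∈ C,
      t ≤ (exceed r u fun k => if σ k then y k else x k) -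
        (exceed r u fun k => if σ k then x k else y k : ℝ)) ⊆
      (traces C r w).biUnion fun s =>
        Finset.univ.filter fun σ : Fin K → Bool => t ≤ ∑ k, if σ k then -a s k else a s k := by
    intro σ hσ
    obtain ⟨u, hu, hut⟩ := (Finset.mem_filter.1 hσ).2
    refine Finset.mem_biUnion.2 ⟨Finset.univ.filter fun j => r < inner ℝ (w j) u, ?_, ?_⟩
    · exact Finset.mem_filter.2 ⟨Finset.mem_univ _, u, hu, fun i => by simp⟩
    · refine Finset.mem_filter.2 ⟨Finset.mem_univ _, hut.trans (le_of_eq ?_)⟩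
      rw [exceed_eq_sum, exceed_eq_sum, ← Finset.sum_sub_distrib]
      refine Finset.sum_congr rfl fun k _ => ?_
      cases h : σ k <;> simp [a, hw]
  calc _ ≤ (((traces C r w).biUnion fun s => Finset.univ.filter
        fun σ : Fin K → Bool => t ≤ ∑ k, if σ k then -a s k else a s k).card : ℝ) := by
        exact_mod_cast Finset.card_le_card hsub
    _ ≤ ∑ s ∈ traces C r w, ((Finset.univ.filter
        fun σ : Fin K → Bool => t ≤ ∑ k, if σ k then -a s k else a s k).card : ℝ) := by
        exact_mod_cast Finset.card_biUnion_le
    _ ≤ ∑ s ∈ traces C r w, 2 ^ K * Real.exp (-t ^ 2 / (2 * K)) := by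
        refine Finset.sum_le_sum fun s _ => card_signs_le hK _ (fun k => ?_) ht
        simp only [a]
        split_ifs <;> norm_num
    _ = _ := by rw [Finset.sum_const, nsmul_eq_mul]

/-- A uniform deviation bound for half-spaces indexed by a countable set, by comparison with an
independent copy of the data and random exchanges of the two copies. -/
theorem measureReal_exists_exceed_le {d K : ℕ} (hK : 0 < K) {Z : Type*} [MeasurableSpace Z]
    (M : Measure Z) [IsProbabilityMeasure M] (g : Z → Fin K → Vec d) (hg : Measurable g)
    (T : (Fin K → Bool) → Z × Z → Z × Z)
    (hT : ∀ σ, MeasurePreserving (T σ) (M.prod M) (M.prod M))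
    (hT1 : ∀ σ z, g (T σ z).1 = fun k => if σ k then g z.2 k else g z.1 k)
    (hT2 : ∀ σ z, g (T σ z).2 = fun k => if σ k then g z.1 k else g z.2 k)
    {C : Set (Vec d)} (hC : C.Countable) (r : ℝ)
    (hprob : ∀ u ∈ C, ∀ k, M.real {z | r < inner ℝ (g z k) u} ≤ 1 / 8) {G : ℝ}
    (hG : ∀ w : Fin K × Bool → Vec d, 2 * ((traces C r w).card : ℝ) ≤ G) :
    M.real {z | ∃ u ∈ C, 7 * (K : ℝ) / 16 ≤ exceed r u (g z)} ≤
      G * Real.exp (-(9 * K / 512)) := by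
  classical
  have hK' : (0 : ℝ) < K := by exact_mod_cast hK
  have hmeas : ∀ u, Measurable fun z => (exceed r u (g z) : ℝ) := fun u =>
    (measurable_exceed r u).comp hg
  set Bad : Set Z := {z | ∃ u ∈ C, 7 * (K : ℝ) / 16 ≤ exceed r u (g z)} with hBad
  -- The second component is the ghost sample; on `B` the two counts differ by at least `7K/16 - K/4
  -- = 3K/16`.
  set B : Set (Z × Z) := {z | ∃ u ∈ C, 7 * (K : ℝ) / 16 ≤ exceed r u (g z.1) ∧
    (exceed r u (g z.2) : ℝ) ≤ K / 4} with hB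
  have hBadm : MeasurableSet Bad := by
    have : Bad = ⋃ u ∈ C, {z | 7 * (K : ℝ) / 16 ≤ exceed r u (g z)} := by ext; simp [hBad]
    rw [this]
    exact .biUnion hC fun u _ => measurableSet_le measurable_const (hmeas u)
  have hBm : MeasurableSet B := by
    have : B = ⋃ u ∈ C, ({z | 7 * (K : ℝ) / 16 ≤ exceed r u (g z.1)} ∩
      {z | (exceed r u (g z.2) : ℝ) ≤ K / 4}) := by
      ext
      simp only [hB, Set.mem_iUnion, Set.mem_inter_iff, Set.mem_ofPred_eq, exists_prop]
    rw [this]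
    exact .biUnion hC fun u _ =>
      (measurableSet_le measurable_const ((hmeas u).comp measurable_fst)).inter
        (measurableSet_le ((hmeas u).comp measurable_snd) measurable_const)
  -- The expected count is at most `K/8`, so Markov at level `K/4` loses a factor 1/2.
  have hmarkov : ∀ u ∈ C, 1 / 2 ≤ M.real {z | (exceed r u (g z) : ℝ) ≤ K / 4} := by
    intro u hu
    have hset : ∀ k, MeasurableSet {z | r < inner ℝ (g z k) u} := fun k =>
      measurableSet_lt measurable_const (by fun_prop)
    have hsum : ∀ z, (exceed r u (g z) : ℝ) =
        ∑ k, ({z | r < inner ℝ (g z k) u}).indicator (fun _ => (1 : ℝ)) z := by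
      intro z
      rw [exceed_eq_sum]
      refine Finset.sum_congr rfl fun k _ => ?_
      simp [Set.indicator_apply]
    have hint : ∀ k, Integrable (({z | r < inner ℝ (g z k) u}).indicator
        (fun _ => (1 : ℝ))) M := fun k => (integrable_const _).indicator (hset k)
    have hE : ∫ z, (exceed r u (g z) : ℝ) ∂M ≤ K / 8 := by
      simp_rw [hsum]
      rw [integral_finsetSum _ fun k _ => hint k]
      calc _ = ∑ k, M.real {z | r < inner ℝ (g z k) u} := by
            refine Finset.sum_congr rfl fun k _ => ?_
            rw [integral_indicator (hset k)]
            simp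
        _ ≤ ∑ _k : Fin K, (1 / 8 : ℝ) := Finset.sum_le_sum fun k _ => hprob u hu k
        _ = _ := by simp; ring
    have hI : Integrable (fun z => (exceed r u (g z) : ℝ)) M := by
      simp_rw [hsum]
      exact integrable_finsetSum _ fun k _ => hint k
    have h1 := mul_meas_ge_le_integral_of_nonneg (μ := M)
      (f := fun z => (exceed r u (g z) : ℝ)) (ae_of_all _ fun z => by positivity) hI (K / 4)
    have h2 : M.real {z | (K : ℝ) / 4 ≤ exceed r u (g z)} ≤ 1 / 2 := by
      have : (K : ℝ) / 4 * M.real {z | (K : ℝ) / 4 ≤ exceed r u (g z)} ≤ K / 4 * (1 / 2) := by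
        linarith
      exact le_of_mul_le_mul_left this (by positivity)
    have h3 : {z | (exceed r u (g z) : ℝ) ≤ K / 4}ᶜ ⊆
        {z | (K : ℝ) / 4 ≤ exceed r u (g z)} := fun z hz => by
      simp only [Set.mem_compl_iff, Set.mem_ofPred_eq, not_le] at hz ⊢
      exact hz.le
    have h4 := measureReal_mono (μ := M) h3
    rw [measureReal_compl (measurableSet_le (hmeas u) measurable_const)] at h4
    simp only [probReal_univ] at h4
    linarith
  -- For a bad `z`, fix a witness `u`; the independent ghost sample satisfies the second condition
  -- for this `u` with probability at least 1/2. Fubini concludes.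
  have hghost : M.real Bad ≤ 2 * (M.prod M).real B := by
    have h1 : ENNReal.ofReal (1 / 2) * M Bad ≤ (M.prod M) B := by
      rw [Measure.prod_apply hBm, ← lintegral_indicator_const hBadm]
      refine lintegral_mono fun z => ?_
      by_cases hz : z ∈ Bad
      · obtain ⟨u, hu, huz⟩ := hz
        rw [Set.indicator_of_mem (show z ∈ Bad from ⟨u, hu, huz⟩)]
        calc ENNReal.ofReal (1 / 2) ≤ M {z | (exceed r u (g z) : ℝ) ≤ K / 4} := by
              rw [← ofReal_measureReal]
              exact ENNReal.ofReal_le_ofReal (hmarkov u hu)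
          _ ≤ M (Prod.mk z ⁻¹' B) := measure_mono fun z' hz' => ⟨u, hu, huz, hz'⟩
      · simp [Set.indicator_of_notMem hz]
    have h2 := ENNReal.toReal_mono (measure_ne_top _ _) h1
    rw [ENNReal.toReal_mul, ENNReal.toReal_ofReal (by norm_num)] at h2
    change 1 / 2 * M.real Bad ≤ (M.prod M).real B at h2
    linarith
  have hpt : ∀ z, ((Finset.univ.filter fun σ : Fin K → Bool => T σ z ∈ B).card : ℝ) ≤
      G / 2 * (2 ^ K * Real.exp (-(9 * K / 512))) := by
    intro z
    calc ((Finset.univ.filter fun σ : Fin K → Bool => T σ z ∈ B).card : ℝ)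
        ≤ ((Finset.univ.filter fun σ : Fin K → Bool => ∃ u ∈ C, 3 * (K : ℝ) / 16 ≤
          (exceed r u fun k => if σ k then g z.2 k else g z.1 k) -
          (exceed r u fun k => if σ k then g z.1 k else g z.2 k : ℝ)).card : ℝ) := by
          refine Nat.cast_le.2 (Finset.card_le_card fun σ hσ => ?_)
          obtain ⟨u, hu, h1, h2⟩ := (Finset.mem_filter.1 hσ).2
          rw [hT1] at h1
          rw [hT2] at h2
          exact Finset.mem_filter.2 ⟨Finset.mem_univ _, u, hu, by linarith⟩
      _ ≤ _ := card_swaps_le hK C r _ (by positivity) _ _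
      _ ≤ _ := by
          have : -(3 * (K : ℝ) / 16) ^ 2 / (2 * K) = -(9 * K / 512) := by field_simp; norm_num
          rw [this]
          refine mul_le_mul_of_nonneg_right ?_ (by positivity)
          linarith [hG fun j : Fin K × Bool => if j.2 then g z.2 j.1 else g z.1 j.1]
  -- Every exchange `T σ` preserves the product measure, so the probability of `B` is the average
  -- over `σ` of those of its preimages, and the pointwise count `hpt` can be integrated.
  have hsym : 2 ^ K * (M.prod M).real B ≤ G / 2 * (2 ^ K * Real.exp (-(9 * K / 512))) := by
    have hTm : ∀ σ, MeasurableSet (T σ ⁻¹' B) := fun σ => (hT σ).measurable hBm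
    have hint : ∀ σ, Integrable ((T σ ⁻¹' B).indicator fun _ => (1 : ℝ)) (M.prod M) :=
      fun σ => (integrable_const _).indicator (hTm σ)
    calc 2 ^ K * (M.prod M).real B = ∑ σ : Fin K → Bool, (M.prod M).real (T σ ⁻¹' B) := by
          simp_rw [fun σ => (hT σ).measureReal_preimage hBm.nullMeasurableSet]
          simp
      _ = ∑ σ : Fin K → Bool, ∫ z, (T σ ⁻¹' B).indicator (fun _ => (1 : ℝ)) z ∂(M.prod M) := by
          refine Finset.sum_congr rfl fun σ _ => ?_
          rw [integral_indicator (hTm σ)]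
          simp
      _ = ∫ z, ∑ σ : Fin K → Bool, (T σ ⁻¹' B).indicator (fun _ => (1 : ℝ)) z ∂(M.prod M) :=
          (integral_finsetSum _ fun σ _ => hint σ).symm
      _ ≤ ∫ _z, G / 2 * (2 ^ K * Real.exp (-(9 * K / 512))) ∂(M.prod M) := by
          refine integral_mono (integrable_finsetSum _ fun σ _ => hint σ) (integrable_const _)
            fun z => ?_
          refine le_trans (le_of_eq ?_) (hpt z)
          simp [Set.indicator_apply]
      _ = _ := by simp
  have hpow : (0 : ℝ) < 2 ^ K := by positivity
  have : (M.prod M).real B ≤ G / 2 * Real.exp (-(9 * K / 512)) := by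
    refine le_of_mul_le_mul_left (hsym.trans (le_of_eq ?_)) hpow
    ring
  linarith

end MOM

namespace MOM

/-! ### The median -/

/-- If an order statistic at position at most `K / 2` were above `r`, so would be all later ones, at
least half of the values. This covers both middle positions. -/
theorem median_le_of_card {K : ℕ} (x : Fin K → ℝ) {r : ℝ}
    (h : 2 * (Finset.univ.filter fun k => r < x k).card + 1 < K) : median x ≤ r := by
  have hK : 0 < K := by omega
  have key : ∀ j : Fin K, (j : ℕ) ≤ K / 2 → (x ∘ Tuple.sort x) j ≤ r := by
    intro j hj
    by_contra! hlt
    have hsub : (Finset.Ici j).map (Tuple.sort x).toEmbedding ⊆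
        Finset.univ.filter fun k => r < x k := by
      intro k hk
      obtain ⟨i, hi, rfl⟩ := Finset.mem_map.1 hk
      exact Finset.mem_filter.2 ⟨Finset.mem_univ _,
        hlt.trans_le (Tuple.monotone_sort x (Finset.mem_Ici.1 hi))⟩
    have := Finset.card_le_card hsub
    rw [Finset.card_map, Fin.card_Ici] at this
    omega
  unfold median
  rw [dif_pos hK]
  have h1 := key ⟨(K - 1) / 2, by omega⟩ (by simp only; omega)
  have h2 := key ⟨K / 2, by omega⟩ le_rfl
  linarith

theorem le_median_of_card {K : ℕ} (x : Fin K → ℝ) {r : ℝ}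
    (h : 2 * (Finset.univ.filter fun k => x k < r).card + 1 < K) : r ≤ median x := by
  have hK : 0 < K := by omega
  have key : ∀ j : Fin K, (K - 1) / 2 ≤ (j : ℕ) → r ≤ (x ∘ Tuple.sort x) j := by
    intro j hj
    by_contra! hlt
    have hsub : (Finset.Iic j).map (Tuple.sort x).toEmbedding ⊆
        Finset.univ.filter fun k => x k < r := by
      intro k hk
      obtain ⟨i, hi, rfl⟩ := Finset.mem_map.1 hk
      exact Finset.mem_filter.2 ⟨Finset.mem_univ _,
        (Tuple.monotone_sort x (Finset.mem_Iic.1 hi)).trans_lt hlt⟩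
    have := Finset.card_le_card hsub
    rw [Finset.card_map, Fin.card_Iic] at this
    omega
  unfold median
  rw [dif_pos hK]
  have h1 := key ⟨(K - 1) / 2, by omega⟩ le_rfl
  have h2 := key ⟨K / 2, by omega⟩ (by simp only; omega)
  linarith

/-- The condition `0 ≤ r` is there for `K = 0`, where the median is 0 by convention. -/
theorem median_le_of_forall {K : ℕ} (x : Fin K → ℝ) {r : ℝ} (hr : 0 ≤ r) (h : ∀ k, x k ≤ r) :
    median x ≤ r := by
  unfold median
  split_ifs
  · have h1 := fun j => h (Tuple.sort x j)
    simp only [Function.comp]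
    linarith [h1 ⟨(K - 1) / 2, by omega⟩, h1 ⟨K / 2, by omega⟩]
  · exact hr

/-! ### The dual ball -/

section Dual

variable {d : ℕ} {p : Seminorm ℝ (Vec d)}

theorem continuous_seminorm (p : Seminorm ℝ (Vec d)) : Continuous p := by
  exact p.convexOn.locallyLipschitz.continuous

/-- A definite seminorm has a positive minimum on the compact Euclidean sphere (empty when `d = 0`).
This makes the supremum in `dualNorm` a bounded one. -/
theorem exists_norm_le_seminorm (hp : ∀ x, p x = 0 → x = 0) :
    ∃ c : ℝ, 0 < c ∧ ∀ x, ‖x‖ ≤ c * p x := by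
  by_cases hne : (Metric.sphere (0 : Vec d) 1).Nonempty
  · obtain ⟨y, hy, hmin⟩ := (isCompact_sphere (0 : Vec d) 1).exists_isMinOn hne
      (continuous_seminorm p).continuousOn
    have hy1 : ‖y‖ = 1 := by simpa using hy
    have hpos : 0 < p y := lt_of_le_of_ne (apply_nonneg _ _) fun h => by
      have := hp y h.symm
      simp [this] at hy1
    refine ⟨(p y)⁻¹, inv_pos.2 hpos, fun x => ?_⟩
    rcases eq_or_ne x 0 with rfl | hx
    · simp
    have hx' : 0 < ‖x‖ := norm_pos_iff.2 hx
    have h1 : p y ≤ p (‖x‖⁻¹ • x) := hmin (by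
      simp [norm_smul, hx'.ne'])
    rw [map_smul_eq_mul, norm_inv, norm_norm] at h1
    rw [inv_mul_eq_div, le_div_iff₀ hpos]
    calc ‖x‖ * p y ≤ ‖x‖ * (‖x‖⁻¹ * p x) := by gcongr
      _ = p x := by field_simp
  · refine ⟨1, one_pos, fun x => ?_⟩
    have : x = 0 := by
      by_contra hx
      exact hne ⟨‖x‖⁻¹ • x, by simp [norm_smul, norm_ne_zero_iff.2 hx]⟩
    simp [this]

/-- By homogeneity. This form exhibits the dual ball as an intersection of closed half-spaces,
whence closedness and convexity. -/
theorem mem_dualBall_iff (hp : ∀ x, p x = 0 → x = 0) {u : Vec d} :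
    u ∈ dualBall p ↔ ∀ x, inner ℝ x u ≤ p x := by
  obtain ⟨c, hc, hcp⟩ := exists_norm_le_seminorm hp
  have hbdd : BddAbove {t | ∃ x : Vec d, p x ≤ 1 ∧ t = inner ℝ x u} := by
    refine ⟨c * ‖u‖, ?_⟩
    rintro _ ⟨x, hx, rfl⟩
    refine (real_inner_le_norm x u).trans ?_
    gcongr
    exact (hcp x).trans (mul_le_of_le_one_right hc.le hx)
  constructor
  · intro hu x
    rcases (apply_nonneg p x).eq_or_lt with h | h
    · rw [hp x h.symm]; simp
    · have h1 : inner ℝ ((p x)⁻¹ • x) u ≤ dualNorm p u :=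
        le_csSup hbdd ⟨_, by rw [map_smul_eq_mul, norm_inv, Real.norm_of_nonneg h.le,
          inv_mul_cancel₀ h.ne'], rfl⟩
      have h2 := h1.trans hu
      rw [real_inner_smul_left, inv_mul_le_iff₀ h, mul_one] at h2
      exact h2
  · intro h
    refine Real.sSup_le ?_ zero_le_one
    rintro _ ⟨x, hx, rfl⟩
    exact (h x).trans hx

theorem isCompact_dualBall (hp : ∀ x, p x = 0 → x = 0) : IsCompact (dualBall p) := by
  obtain ⟨M, hM⟩ : ∃ M : ℝ, ∀ x ∈ Metric.closedBall (0 : Vec d) 1, p x ≤ M := by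
    obtain ⟨M, hM⟩ := (isCompact_closedBall (0 : Vec d) 1).bddAbove_image
      (continuous_seminorm p).continuousOn
    exact ⟨M, fun x hx => hM ⟨x, hx, rfl⟩⟩
  refine Metric.isCompact_of_isClosed_isBounded ?_ ?_
  · have : dualBall p = ⋂ x, {u | inner ℝ x u ≤ p x} := by
      ext u; simp [mem_dualBall_iff hp]
    rw [this]
    exact isClosed_iInter fun x => isClosed_le (by fun_prop) continuous_const
  · refine isBounded_iff_forall_norm_le.2 ⟨M, fun u hu => ?_⟩
    rcases eq_or_ne u 0 with rfl | hu0
    · simpa using (apply_nonneg p 0).trans (hM 0 (by simp))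
    have h := (mem_dualBall_iff hp).1 hu (‖u‖⁻¹ • u)
    have hn := norm_pos_iff.2 hu0
    rw [real_inner_smul_left, real_inner_self_eq_norm_sq, pow_two, inv_mul_cancel_left₀ hn.ne'] at h
    exact h.trans (hM _ (by simp [norm_smul, hn.ne']))

theorem convex_dualBall (hp : ∀ x, p x = 0 → x = 0) : Convex ℝ (dualBall p) := by
  have : dualBall p = ⋂ x, {u | inner ℝ x u ≤ p x} := by
    ext u; simp [mem_dualBall_iff hp]
  rw [this]
  exact convex_iInter fun x => convex_halfSpace_le (innerₗ (Vec d) x).isLinear _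

theorem neg_mem_dualBall (hp : ∀ x, p x = 0 → x = 0) {u : Vec d} (hu : u ∈ dualBall p) :
    -u ∈ dualBall p := by
  rw [mem_dualBall_iff hp] at hu ⊢
  intro x
  have := hu (-x)
  rwa [map_neg_eq_map, inner_neg_left, ← inner_neg_right] at this

theorem neg_mem_dualExtreme (hp : ∀ x, p x = 0 → x = 0) {u : Vec d} (hu : u ∈ dualExtreme p) :
    -u ∈ dualExtreme p := by
  refine ⟨neg_mem_dualBall hp hu.1, fun x hx y hy hxy => ?_⟩
  have h := hu.2 (neg_mem_dualBall hp hx) (neg_mem_dualBall hp hy) (by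
    obtain ⟨a, b, ha, hb, hab, h⟩ := hxy
    exact ⟨a, b, ha, hb, hab, by rw [smul_neg, smul_neg, ← neg_add, h, neg_neg]⟩)
  rw [← h, neg_neg]

/-- Hahn-Banach extends `c • x ↦ c * p x` from the line of `x` under the domination by `p`; Riesz
represents the extension by a vector. -/
theorem exists_mem_dualBall_inner_eq (hp : ∀ x, p x = 0 → x = 0) (x : Vec d) :
    ∃ u ∈ dualBall p, inner ℝ x u = p x := by
  obtain ⟨g, hg1, hg2⟩ : ∃ g : Vec d →ₗ[ℝ] ℝ, g x = p x ∧ ∀ y, g y ≤ p y := by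
    rcases eq_or_ne x 0 with rfl | hx
    · exact ⟨0, by simp, fun y => by simp⟩
    let f : Vec d →ₗ.[ℝ] ℝ := LinearPMap.mkSpanSingleton x (p x) hx
    obtain ⟨g, hg1, hg2⟩ := exists_extension_of_le_sublinear f p
      (fun c hc y => by rw [map_smul_eq_mul, Real.norm_of_nonneg hc.le])
      (fun y z => map_add_le_add p y z) (by
        rintro ⟨y, hy⟩
        obtain ⟨c, rfl⟩ := Submodule.mem_span_singleton.1 hy
        change LinearPMap.mkSpanSingleton x (p x) hx ⟨c • x, hy⟩ ≤ p (c • x)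
        rw [LinearPMap.mkSpanSingleton'_apply, map_smul_eq_mul]
        exact mul_le_mul_of_nonneg_right (le_abs_self c) (apply_nonneg _ _))
    refine ⟨g, ?_, hg2⟩
    exact (hg1 ⟨x, Submodule.mem_span_singleton_self x⟩).trans
      (LinearPMap.mkSpanSingleton'_apply_self _ _ _ _)
  have hgi : ∀ y, inner ℝ y ((InnerProductSpace.toDual ℝ (Vec d)).symm
      (LinearMap.toContinuousLinearMap g)) = g y := fun y => by
    rw [real_inner_comm, InnerProductSpace.toDual_symm_apply]; rfl
  exact ⟨_, (mem_dualBall_iff hp).2 fun y => (hgi y).trans_le (hg2 y), (hgi x).trans hg1⟩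

/-- A bound on the extreme points of the dual ball bounds the norm. -/
theorem seminorm_le_of_forall_dualExtreme (hp : ∀ x, p x = 0 → x = 0) {x : Vec d} {c : ℝ}
    (h : ∀ u ∈ dualExtreme p, inner ℝ x u ≤ c) : p x ≤ c := by
  obtain ⟨u, hu, hux⟩ := exists_mem_dualBall_inner_eq hp x
  -- Krein-Milman: the bound `c` passes from the extreme points to their closed convex hull, which
  -- contains a vector norming `x`.
  rw [← closure_convexHull_extremePoints (isCompact_dualBall hp) (convex_dualBall hp)] at hu
  have : closure (convexHull ℝ ((dualBall p).extremePoints ℝ)) ⊆ {v | inner ℝ x v ≤ c} :=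
    closure_minimal (convexHull_min h (convex_halfSpace_le (innerₗ (Vec d) x).isLinear _))
      (isClosed_le (by fun_prop) continuous_const)
  exact hux ▸ this hu

/-- Some extreme `u` has `⟨x, u⟩ > 0`, and `-u` is extreme too, so `{x}` is shattered. Together with
`16384 * V ≤ K` this forces `K ≥ 16384`. -/
theorem one_le_vcDimVec_dualExtreme (hd : 0 < d) (hp : ∀ x, p x = 0 → x = 0) :
    1 ≤ vcDimVec (dualExtreme p) := by
  let x : Vec d := EuclideanSpace.single ⟨0, hd⟩ 1
  have hx : x ≠ 0 := fun h => by
    have := congrArg (fun v : Vec d => v ⟨0, hd⟩) h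
    simp [x] at this
  have hpx : 0 < p x := lt_of_le_of_ne (apply_nonneg _ _) fun h => hx (hp x h.symm)
  obtain ⟨u, hu, hux⟩ : ∃ u ∈ dualExtreme p, 0 < inner ℝ x u := by
    by_contra! h
    exact hpx.not_ge (seminorm_le_of_forall_dualExtreme hp h)
  have := le_vcDimVec_of_forall (n := 1) (C := dualExtreme p) (fun _ => x) fun b => by
    by_cases hb : (0 : Fin 1) ∈ b
    · exact ⟨u, hu, fun i => by
        rw [Subsingleton.elim i 0]
        simp [hb, hux.le]⟩
    · exact ⟨-u, neg_mem_dualExtreme hp hu, fun i => by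
        rw [Subsingleton.elim i 0]
        simp [hb, hux]⟩
  simpa using this

/-! ### The deterministic argument -/

/-- If the projections of the block means around `μ` are rarely above `r`, then every minimizer of
the criterion is within `2 r` of `μ`. -/
theorem seminorm_sub_le_of_exceed {N K : ℕ} (hp : ∀ x, p x = 0 → x = 0) (S : BlockSplit N K)
    (x : Fin N → Vec d) {a μ : Vec d} (ha : IsMomEstimate p S x a) {r : ℝ} (hr : 0 ≤ r)
    (h : ∀ u ∈ dualExtreme p, 2 * exceed r u (fun k => blockMean S x k - μ) + 1 < K) :
    p (a - μ) ≤ 2 * r := by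
  have h1 : criterion p S x μ ≤ r := by
    refine Real.sSup_le ?_ hr
    rintro _ ⟨u, hu, rfl⟩
    refine median_le_of_card _ ?_
    convert h u hu using 4
    unfold exceed
    congr!
  have hbdd : BddAbove ((fun u : Vec d => median fun k => inner ℝ (blockMean S x k - a) u) ''
      dualExtreme p) := by
    obtain ⟨R, hR⟩ := isBounded_iff_forall_norm_le.1 (isCompact_dualBall hp).isBounded
    refine ⟨∑ k, ‖blockMean S x k - a‖ * |R|, ?_⟩
    rintro _ ⟨u, hu, rfl⟩
    refine median_le_of_forall _ (by positivity) fun k => ?_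
    calc inner ℝ (blockMean S x k - a) u ≤ ‖blockMean S x k - a‖ * ‖u‖ := real_inner_le_norm _ _
      _ ≤ ‖blockMean S x k - a‖ * |R| := by
        gcongr
        exact (hR u hu.1).trans (le_abs_self R)
      _ ≤ _ := Finset.single_le_sum (f := fun k => ‖blockMean S x k - a‖ * |R|)
        (fun _ _ => by positivity) (Finset.mem_univ k)
  rw [← map_neg_eq_map, neg_sub]
  refine seminorm_le_of_forall_dualExtreme hp fun u hu => ?_
  have h2 : (median fun k => inner ℝ (blockMean S x k - a) u) ≤ r :=
    ((le_csSup hbdd ⟨u, hu, rfl⟩).trans (ha μ)).trans h1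
  have h3 : inner ℝ (μ - a) u - r ≤ median fun k => inner ℝ (blockMean S x k - a) u := by
    refine le_median_of_card _ ?_
    -- A projection on `u` below `-r` is an exceedance of `r` in direction `-u`.
    have h' := h (-u) (neg_mem_dualExtreme hp hu)
    have hsub : (Finset.univ.filter fun k =>
        inner ℝ (blockMean S x k - a) u < inner ℝ (μ - a) u - r).card ≤
        exceed r (-u) fun k => blockMean S x k - μ := by
      refine Finset.card_le_card fun k hk => ?_
      have hk := (Finset.mem_filter.1 hk).2
      refine Finset.mem_filter.2 ⟨Finset.mem_univ _, ?_⟩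
      rw [show blockMean S x k - a = (blockMean S x k - μ) + (μ - a) by abel,
        inner_add_left] at hk
      rw [inner_neg_right]
      linarith
    omega
  linarith

/-- Changing the data at the indices of `O` changes at most `#O` block means. -/
theorem exceed_blockMean_le {N K : ℕ} (S : BlockSplit N K) {x y : Fin N → Vec d}
    {O : Finset (Fin N)} (hxy : ∀ i, i ∉ O → x i = y i) (r : ℝ) (u μ : Vec d) :
    exceed r u (fun k => blockMean S x k - μ) ≤
      exceed r u (fun k => blockMean S y k - μ) + O.card := by
  classical
  -- Blocks are disjoint, so each outlier lies in at most one of them.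
  have hcorr : (Finset.univ.filter fun k => ∃ i ∈ O, i ∈ S.block k).card ≤ O.card := by
    refine Finset.card_le_card_of_forall_subsingleton (fun k i => i ∈ S.block k)
      (fun k hk => (Finset.mem_filter.1 hk).2) fun i _ k hk l hl => ?_
    by_contra hne
    exact Finset.disjoint_left.1 (S.disjoint k l hne) hk.2 hl.2
  unfold exceed
  refine (Finset.card_le_card (t := (Finset.univ.filter fun k =>
    r < inner ℝ (blockMean S y k - μ) u) ∪ Finset.univ.filter fun k => ∃ i ∈ O, i ∈ S.block k)
    fun k hk => ?_).trans ((Finset.card_union_le _ _).trans ?_)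
  · by_cases h : ∃ i ∈ O, i ∈ S.block k
    · exact Finset.mem_union_right _ (by simpa using h)
    · push Not at h
      have : blockMean S x k = blockMean S y k := by
        unfold blockMean
        rw [Finset.sum_congr rfl fun i hi => hxy i fun hO => h i hO hi]
      refine Finset.mem_union_left _ ?_
      simpa [this] using hk
  · convert Nat.add_le_add_left hcorr _

end Dual

end MOM

namespace MOM

/-! ### Block means and exchanges of samples -/

section Blocks

variable {d : ℕ}

theorem measurable_blockMean {N K : ℕ} (S : BlockSplit N K) (k : Fin K) :
    Measurable fun y : Fin N → Vec d => blockMean S y k := by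
  unfold blockMean
  fun_prop

theorem inner_blockMean {N K : ℕ} (S : BlockSplit N K) (y : Fin N → Vec d) (k : Fin K) (u : Vec d) :
    inner ℝ (blockMean S y k) u = ((N / K : ℕ) : ℝ)⁻¹ * ∑ i ∈ S.block k, inner ℝ (y i) u := by
  rw [blockMean, real_inner_smul_left, sum_inner]

open Classical in
/-- Exchange of two samples on the blocks selected by `σ`. -/
noncomputable def blockSwap {N K : ℕ} (S : BlockSplit N K) (σ : Fin K → Bool)
    (z : (Fin N → Vec d) × (Fin N → Vec d)) : (Fin N → Vec d) × (Fin N → Vec d) :=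
  (fun i => if ∃ k, i ∈ S.block k ∧ σ k then z.2 i else z.1 i,
    fun i => if ∃ k, i ∈ S.block k ∧ σ k then z.1 i else z.2 i)

theorem exists_mem_block_iff {N K : ℕ} (S : BlockSplit N K) (σ : Fin K → Bool) {k : Fin K}
    {i : Fin N} (hi : i ∈ S.block k) : (∃ l, i ∈ S.block l ∧ σ l) ↔ σ k := by
  refine ⟨?_, fun h => ⟨k, hi, h⟩⟩
  rintro ⟨l, hl, h⟩
  by_cases hkl : l = k
  · exact hkl ▸ h
  · exact (Finset.disjoint_left.1 (S.disjoint l k hkl) hl hi).elim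

theorem blockMean_blockSwap_fst {N K : ℕ} (S : BlockSplit N K) (σ : Fin K → Bool)
    (z : (Fin N → Vec d) × (Fin N → Vec d)) (k : Fin K) :
    blockMean S (blockSwap S σ z).1 k = if σ k then blockMean S z.2 k else blockMean S z.1 k := by
  classical
  have : ∀ i ∈ S.block k, (blockSwap S σ z).1 i = if σ k then z.2 i else z.1 i := fun i hi => by
    simp only [blockSwap, exists_mem_block_iff S σ hi]
  rw [blockMean, Finset.sum_congr rfl this]
  split_ifs <;> rfl

theorem blockMean_blockSwap_snd {N K : ℕ} (S : BlockSplit N K) (σ : Fin K → Bool)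
    (z : (Fin N → Vec d) × (Fin N → Vec d)) (k : Fin K) :
    blockMean S (blockSwap S σ z).2 k = if σ k then blockMean S z.1 k else blockMean S z.2 k := by
  classical
  have : ∀ i ∈ S.block k, (blockSwap S σ z).2 i = if σ k then z.1 i else z.2 i := fun i hi => by
    simp only [blockSwap, exists_mem_block_iff S σ hi]
  rw [blockMean, Finset.sum_congr rfl this]
  split_ifs <;> rfl

end Blocks

/-! ### Covariance and variance of projections -/

section Moments

variable {d : ℕ}

theorem memLp_inner {ν : Measure (Vec d)} (hν : MemLp id 2 ν) (u : Vec d) : MemLp (fun x => inner ℝ x u) 2 ν := by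
  simpa using hν.inner_const (𝕜 := ℝ) u

theorem tripleNorm_nonneg (p : Seminorm ℝ (Vec d)) (A : Matrix (Fin d) (Fin d) ℝ) :
    0 ≤ tripleNorm p A := by
  refine Real.sSup_nonneg ?_
  rintro _ ⟨u, -, rfl⟩
  exact norm_nonneg _

theorem norm_le_tripleNorm {p : Seminorm ℝ (Vec d)} (hp : ∀ x, p x = 0 → x = 0)
    (A : Matrix (Fin d) (Fin d) ℝ) {u : Vec d} (hu : u ∈ dualBall p) :
    ‖Matrix.toEuclideanCLM (𝕜 := ℝ) A u‖ ≤ tripleNorm p A :=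
  le_csSup ((isCompact_dualBall hp).bddAbove_image (by fun_prop)) ⟨u, hu, rfl⟩

variable {ν : Measure (Vec d)} [IsProbabilityMeasure ν]

theorem integral_inner_mean (hν : MemLp id 2 ν) (u : Vec d) :
    ∫ x, inner ℝ x u ∂ν = inner ℝ (mean ν) u := by
  simp_rw [real_inner_comm u]
  exact integral_inner (𝕜 := ℝ) (hν.integrable one_le_two) u

theorem dotProduct_covMat_mulVec (hν : MemLp id 2 ν) (u : Vec d) :
    u.ofLp ⬝ᵥ (covMat ν).mulVec u.ofLp = Var[fun x => inner ℝ x u; ν] := by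
  have hcoord : ∀ i, MemLp (fun x : Vec d => x i - mean ν i) 2 ν := fun i => by
    have h := (memLp_inner hν (EuclideanSpace.single i 1)).sub (memLp_const (mean ν i))
    simpa [Pi.sub_def, EuclideanSpace.inner_single_right] using h
  have hint : ∀ i j, Integrable
      (fun x : Vec d => u i * ((x i - mean ν i) * (x j - mean ν j) * u j)) ν := fun i j =>
    (((hcoord i).integrable_mul (hcoord j)).mul_const _).const_mul _
  rw [variance_eq_integral (memLp_inner hν u).aestronglyMeasurable.aemeasurable,
    integral_inner_mean hν]
  have hsq : ∀ x : Vec d, (inner ℝ x u - inner ℝ (mean ν) u) ^ 2 =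
      ∑ i, ∑ j, u i * ((x i - mean ν i) * (x j - mean ν j) * u j) := by
    intro x
    rw [← inner_sub_left, PiLp.inner_apply, pow_two, Finset.sum_mul_sum]
    refine Finset.sum_congr rfl fun i _ => Finset.sum_congr rfl fun j _ => ?_
    simp only [PiLp.sub_apply, RCLike.inner_apply, conj_trivial]
    ring
  simp_rw [hsq]
  rw [integral_finsetSum _ fun i _ => integrable_finsetSum _ fun j _ => hint i j]
  refine Finset.sum_congr rfl fun i _ => ?_
  rw [integral_finsetSum _ fun j _ => hint i j, Matrix.mulVec, dotProduct, Finset.mul_sum]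
  refine Finset.sum_congr rfl fun j _ => ?_
  rw [integral_const_mul, integral_mul_const]
  rfl

open scoped MatrixOrder in
theorem norm_sqrtCov_sq (hν : MemLp id 2 ν) (u : Vec d) :
    ‖Matrix.toEuclideanCLM (𝕜 := ℝ) (sqrtCov ν) u‖ ^ 2 = Var[fun x => inner ℝ x u; ν] := by
  -- The square root squares back to the covariance only for a nonnegative matrix; here the
  -- quadratic form is a variance.
  have hpsd : (covMat ν).PosSemidef := by
    refine Matrix.PosSemidef.of_dotProduct_mulVec_nonneg ?_ fun x => ?_
    · ext i j
      simp [covMat, mul_comm]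
    · have := dotProduct_covMat_mulVec hν (WithLp.toLp 2 x)
      simp only at this
      rw [star_trivial, this]
      exact variance_nonneg _ _
  have hsa : star (sqrtCov ν) = sqrtCov ν :=
    (IsSelfAdjoint.of_nonneg (CFC.sqrt_nonneg (covMat ν))).star_eq
  have hmul : sqrtCov ν * sqrtCov ν = covMat ν :=
    CFC.sqrt_mul_sqrt_self (covMat ν) (Matrix.nonneg_iff_posSemidef.2 hpsd)
  have hadj : ContinuousLinearMap.adjoint (Matrix.toEuclideanCLM (𝕜 := ℝ) (sqrtCov ν)) =
      Matrix.toEuclideanCLM (𝕜 := ℝ) (sqrtCov ν) := by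
    rw [← ContinuousLinearMap.star_eq_adjoint, ← map_star, hsa]
  rw [← dotProduct_covMat_mulVec hν, ← Matrix.inner_toEuclideanCLM, ← real_inner_self_eq_norm_sq,
    ← ContinuousLinearMap.adjoint_inner_right, hadj, ← hmul, map_mul]
  rfl

theorem variance_inner_le {p : Seminorm ℝ (Vec d)} (hp : ∀ x, p x = 0 → x = 0)
    (hν : MemLp id 2 ν) {u : Vec d} (hu : u ∈ dualBall p) :
    Var[fun x => inner ℝ x u; ν] ≤ tripleNorm p (sqrtCov ν) ^ 2 := by
  rw [← norm_sqrtCov_sq hν]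
  gcongr
  exact norm_le_tripleNorm hp _ hu

/-! ### Distribution of the block means -/

theorem memLp_inner_eval {N : ℕ} (hν : MemLp id 2 ν) (u : Vec d) (i : Fin N) :
    MemLp (fun y : Fin N → Vec d => inner ℝ (y i) u) 2 (Measure.pi fun _ => ν) :=
  (memLp_inner hν u).comp_measurePreserving (measurePreserving_eval (fun _ : Fin N => ν) i)

theorem memLp_inner_blockMean {N K : ℕ} (hν : MemLp id 2 ν) (S : BlockSplit N K) (k : Fin K)
    (u : Vec d) :
    MemLp (fun y : Fin N → Vec d => inner ℝ (blockMean S y k) u) 2 (Measure.pi fun _ => ν) := by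
  simp_rw [inner_blockMean]
  exact (memLp_finsetSum _ fun i _ => memLp_inner_eval hν u i).const_mul _

theorem integral_inner_blockMean {N K : ℕ} (hm : N / K ≠ 0) (hν : MemLp id 2 ν)
    (S : BlockSplit N K) (k : Fin K) (u : Vec d) :
    ∫ y, inner ℝ (blockMean S y k) u ∂(Measure.pi fun _ : Fin N => ν) = inner ℝ (mean ν) u := by
  simp_rw [inner_blockMean]
  rw [integral_const_mul, integral_finsetSum _ fun i _ =>
    (memLp_inner_eval hν u i).integrable one_le_two]
  have : ∀ i : Fin N, ∫ y, inner ℝ (y i) u ∂(Measure.pi fun _ : Fin N => ν) =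
      inner ℝ (mean ν) u := fun i => by
    rw [integral_comp_eval (μ := fun _ : Fin N => ν) (f := fun x => inner ℝ x u)
      (memLp_inner hν u).aestronglyMeasurable, integral_inner_mean hν]
  simp_rw [this]
  rw [Finset.sum_const, S.card_block, nsmul_eq_mul, inv_mul_cancel_left₀ (by exact_mod_cast hm)]

theorem variance_inner_blockMean {N K : ℕ} (hm : N / K ≠ 0) (hν : MemLp id 2 ν)
    (S : BlockSplit N K) (k : Fin K) (u : Vec d) :
    Var[fun y : Fin N → Vec d => inner ℝ (blockMean S y k) u; Measure.pi fun _ => ν] =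
      Var[fun x => inner ℝ x u; ν] / (N / K : ℕ) := by
  simp_rw [inner_blockMean]
  have hind : iIndepFun (fun (i : Fin N) (y : Fin N → Vec d) => (inner ℝ (y i) u : ℝ))
      (Measure.pi fun _ => ν) :=
    iIndepFun_pi (μ := fun _ : Fin N => ν) (X := fun _ x => (inner ℝ x u : ℝ))
      fun _ => (memLp_inner hν u).aestronglyMeasurable.aemeasurable
  have hsum : Var[∑ i ∈ S.block k, fun y : Fin N → Vec d => (inner ℝ (y i) u : ℝ);
      Measure.pi fun _ => ν] = ∑ i ∈ S.block k,
      Var[fun y : Fin N → Vec d => (inner ℝ (y i) u : ℝ); Measure.pi fun _ => ν] :=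
    IndepFun.variance_sum (fun i _ => memLp_inner_eval hν u i)
      fun i _ j _ hij => hind.indepFun hij
  have hvar : ∀ i : Fin N, Var[fun y : Fin N → Vec d => inner ℝ (y i) u; Measure.pi fun _ => ν] =
      Var[fun x => inner ℝ x u; ν] := fun i =>
    (measurePreserving_eval (fun _ : Fin N => ν) i).variance_fun_comp
      (f := fun x : Vec d => (inner ℝ x u : ℝ)) (memLp_inner hν u).aestronglyMeasurable.aemeasurable
  rw [Finset.sum_congr rfl fun i _ => hvar i, Finset.sum_const, S.card_block,
    nsmul_eq_mul] at hsum
  rw [variance_const_mul]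
  have hfun : (fun y : Fin N → Vec d => ∑ i ∈ S.block k, inner ℝ (y i) u) =
      ∑ i ∈ S.block k, fun y : Fin N → Vec d => (inner ℝ (y i) u : ℝ) := by
    ext y; simp
  have hm' : ((N / K : ℕ) : ℝ) ≠ 0 := by exact_mod_cast hm
  rw [hfun, hsum]
  field_simp

/-- Chebyshev: with `m = N / K` (integer division) the variance is at most `s² / m`, so the
probability is at most `N / (16 K m)`, and `N ≤ 2 K m`. -/
theorem measureReal_inner_blockMean_le {N K : ℕ} (hK : 1 ≤ K) (hKN : K ≤ N)
    {p : Seminorm ℝ (Vec d)} (hp : ∀ x, p x = 0 → x = 0) (hν : MemLp id 2 ν)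
    (S : BlockSplit N K) (k : Fin K) {u : Vec d} (hu : u ∈ dualBall p) :
    (Measure.pi fun _ : Fin N => ν).real {y |
      4 * tripleNorm p (sqrtCov ν) * √(K / N) < inner ℝ (blockMean S y k - mean ν) u} ≤ 1 / 8 := by
  have hm : N / K ≠ 0 := (Nat.div_pos hKN hK).ne'
  have hm' : (0 : ℝ) < (N / K : ℕ) := by exact_mod_cast Nat.pos_of_ne_zero hm
  have hN' : (0 : ℝ) < N := by exact_mod_cast hK.trans hKN
  have hK' : (0 : ℝ) < K := by exact_mod_cast hK
  set s := tripleNorm p (sqrtCov ν) with hs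
  have hs0 : 0 ≤ s := tripleNorm_nonneg _ _
  have hvar := variance_inner_blockMean hm hν S k u
  have hle : Var[fun x => inner ℝ x u; ν] ≤ s ^ 2 := variance_inner_le hp hν hu
  have hmem := memLp_inner_blockMean hν S k u
  have hmean := integral_inner_blockMean hm hν S k u
  simp_rw [inner_sub_left]
  rcases hs0.eq_or_lt with h0 | hpos
  -- When `s = 0` Chebyshev is void, but the projection is almost surely constant and the strict
  -- inequality makes the event null.
  · have hv0 : Var[fun x => inner ℝ x u; ν] = 0 :=
      le_antisymm (by simpa [← h0] using hle) (variance_nonneg _ _)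
    rw [hv0, zero_div] at hvar
    have hae := ae_eq_integral_of_variance_eq_zero hmem hvar
    rw [hmean] at hae
    rw [measureReal_def, measure_eq_zero_iff_ae_notMem.2]
    · norm_num
    · filter_upwards [hae] with y hy
      simp [← h0, hy]
  · have hr : 0 < 4 * s * √(K / N) := by positivity
    have hch := meas_ge_le_variance_div_sq hmem hr
    rw [hmean, hvar] at hch
    have hsub : {y : Fin N → Vec d | 4 * s * √(K / N) <
        inner ℝ (blockMean S y k) u - inner ℝ (mean ν) u} ⊆
        {y | 4 * s * √(K / N) ≤ |inner ℝ (blockMean S y k) u - inner ℝ (mean ν) u|} :=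
      fun y hy => by
      simp only [Set.mem_ofPred_eq] at hy ⊢
      exact hy.le.trans (le_abs_self _)
    have h1 := ENNReal.toReal_mono ENNReal.ofReal_ne_top ((measure_mono hsub).trans hch)
    rw [ENNReal.toReal_ofReal (div_nonneg (div_nonneg (variance_nonneg _ _) hm'.le)
      (sq_nonneg _))] at h1
    refine h1.trans ?_
    rw [mul_pow, Real.sq_sqrt (by positivity), div_le_iff₀ (by positivity), div_le_iff₀ hm']
    -- The remainder `N % K` is less than `K`, which is at most `K * (N / K)`.
    have hNm : (N : ℝ) ≤ 2 * (K * (N / K : ℕ)) := by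
      have h2 := Nat.div_add_mod N K
      have h3 := Nat.mod_lt N hK
      have h4 : K ≤ K * (N / K) := Nat.le_mul_of_pos_right _ (Nat.pos_of_ne_zero hm)
      exact_mod_cast (show N ≤ 2 * (K * (N / K)) by omega)
    have h5 : 1 ≤ 2 * ((K : ℝ) / N * (N / K : ℕ)) := by
      rw [div_mul_eq_mul_div, ← mul_div_assoc, le_div_iff₀ hN']
      linarith
    calc Var[fun x => inner ℝ x u; ν] ≤ s ^ 2 * 1 := by linarith
      _ ≤ s ^ 2 * (2 * ((K : ℝ) / N * (N / K : ℕ))) := by gcongr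
      _ = _ := by ring

/-- Two samples of size `N` are `N` independent pairs of law `ν.prod ν`, and each pair is
exchangeable. -/
theorem measurePreserving_blockSwap {N K : ℕ} (S : BlockSplit N K) (σ : Fin K → Bool) :
    MeasurePreserving (blockSwap S σ)
      ((Measure.pi fun _ : Fin N => ν).prod (Measure.pi fun _ : Fin N => ν))
      ((Measure.pi fun _ : Fin N => ν).prod (Measure.pi fun _ : Fin N => ν)) := by
  classical
  have he := measurePreserving_arrowProdEquivProdArrow (Vec d) (Vec d) (Fin N)
    (fun _ => ν) (fun _ => ν)
  have hf : MeasurePreserving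
      (fun (a : Fin N → Vec d × Vec d) i =>
        (if ∃ k, i ∈ S.block k ∧ σ k then Prod.swap else id) (a i))
      (Measure.pi fun _ => ν.prod ν) (Measure.pi fun _ => ν.prod ν) := by
    refine measurePreserving_pi _ _ fun i => ?_
    split_ifs
    · exact Measure.measurePreserving_swap
    · exact MeasurePreserving.id _
  convert he.comp (hf.comp he.symm) using 1
  ext z i : 3 <;>
  · simp only [blockSwap, Function.comp, MeasurableEquiv.arrowProdEquivProdArrow,
      Equiv.arrowProdEquivProdArrow]
    by_cases h : ∃ k, i ∈ S.block k ∧ σ k <;> simp [h]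

theorem measureReal_exists_exceed_blockMean_le {N K V : ℕ} (hK : 1 ≤ K) (hKN : K ≤ N)
    {p : Seminorm ℝ (Vec d)} (hp : ∀ x, p x = 0 → x = 0) (hν : MemLp id 2 ν)
    (S : BlockSplit N K) {C : Set (Vec d)} (hC : C.Countable) (hCp : C ⊆ dualExtreme p)
    (hV : vcDimVec (dualExtreme p) ≤ V) (hV1 : 1 ≤ V) (hVK : 16384 * V ≤ K) :
    (Measure.pi fun _ : Fin N => ν).real {y | ∃ u ∈ C, 7 * (K : ℝ) / 16 ≤
      exceed (4 * tripleNorm p (sqrtCov ν) * √(K / N)) u fun k => blockMean S y k - mean ν} ≤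
      Real.exp (-(K : ℝ) / 128) := by
  classical
  refine (measureReal_exists_exceed_le hK (Measure.pi fun _ : Fin N => ν)
    (fun y k => blockMean S y k - mean ν)
    (measurable_pi_lambda _ fun k => (measurable_blockMean S k).sub_const _)
    (blockSwap S) (measurePreserving_blockSwap S) (fun σ z => ?_) (fun σ z => ?_) hC _
    (fun u hu k => measureReal_inner_blockMean_le hK hKN hp hν S k (hCp hu).1)
    (G := Real.exp (3 * K / 512)) fun w => ?_).trans ?_
  · ext1 k
    rw [blockMean_blockSwap_fst]
    split_ifs <;> rfl
  · ext1 k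
    rw [blockMean_blockSwap_snd]
    split_ifs <;> rfl
  · refine le_trans ?_ (card_traces_le hV hV1 hVK
      (4 * tripleNorm p (sqrtCov ν) * √(K / N)) w)
    gcongr
    intro s hs
    obtain ⟨u, hu, h⟩ := (Finset.mem_filter.1 hs).2
    exact Finset.mem_filter.2 ⟨Finset.mem_univ _, u, hCp hu, h⟩
  -- The exponents add up to `-6K/512`, which is at most `-4K/512 = -K/128`.
  · rw [← Real.exp_add]
    apply Real.exp_le_exp.2
    linarith [Nat.cast_nonneg (α := ℝ) K]

end Moments

/-- The exceedances at `u` are finitely many strict inequalities, so they persist at nearby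
directions. This reduces the extreme points to a countable dense subset, for which the bad event is
measurable. -/
theorem exists_exceed_of_subset_closure {d K : ℕ} {C D : Set (Vec d)} (hCD : C ⊆ closure D)
    {r q : ℝ} {x : Fin K → Vec d} (h : ∃ u ∈ C, q ≤ exceed r u x) : ∃ u ∈ D, q ≤ exceed r u x := by
  classical
  obtain ⟨u, hu, hq⟩ := h
  have hopen : IsOpen {v : Vec d | ∀ k ∈ Finset.univ.filter fun k => r < inner ℝ (x k) u,
      r < inner ℝ (x k) v} := by
    have : {v : Vec d | ∀ k ∈ Finset.univ.filter fun k => r < inner ℝ (x k) u,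
        r < inner ℝ (x k) v} = ⋂ k ∈ Finset.univ.filter fun k => r < inner ℝ (x k) u,
        {v : Vec d | r < inner ℝ (x k) v} := by
      ext; simp
    rw [this]
    exact isOpen_biInter_finset fun k _ => isOpen_lt continuous_const (by fun_prop)
  obtain ⟨v, hv, hvD⟩ := mem_closure_iff.1 (hCD hu) _ hopen
    fun k hk => (Finset.mem_filter.1 hk).2
  refine ⟨v, hvD, hq.trans (Nat.cast_le.2 (Finset.card_le_card fun k hk => ?_))⟩
  exact Finset.mem_filter.2 ⟨Finset.mem_univ _, hv k (by simpa using hk)⟩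

end MOM

/-! ### Random splits independent of the data -/

namespace MOM

instance (N K : ℕ) : Countable (BlockSplit N K) :=
  Function.Injective.countable (f := BlockSplit.block) fun S T h => by
    cases S; cases T; congr

theorem measurable_exceed_blockMean {d N K : ℕ} (S : BlockSplit N K) (r : ℝ) (u μ : Vec d) :
    Measurable fun y : Fin N → Vec d => (exceed r u fun k => blockMean S y k - μ : ℝ) :=
  (measurable_exceed r u).comp
    (measurable_pi_lambda _ fun k => (measurable_blockMean S k).sub_const _)

/-- Bounds uniform over the splits carry over to a random split independent of the data. -/
theorem measureReal_mem_le_of_indepFun {Ω α β : Type*} [MeasurableSpace Ω] [MeasurableSpace α]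
    [MeasurableSpace β] [Countable α] [MeasurableSingletonClass α] {P : Measure Ω}
    [IsProbabilityMeasure P] {S : Ω → α} {Y : Ω → β} (hS : AEMeasurable S P)
    (hY : AEMeasurable Y P) (hSY : IndepFun S Y P) (B : α → Set β)
    (hB : ∀ s, MeasurableSet (B s)) {c : ℝ} (hc : ∀ s, (P.map Y).real (B s) ≤ c) :
    P.real {ω | Y ω ∈ B (S ω)} ≤ c := by
  have : IsProbabilityMeasure (P.map S) := Measure.isProbabilityMeasure_map hS
  have : IsProbabilityMeasure (P.map Y) := Measure.isProbabilityMeasure_map hY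
  have hD : MeasurableSet {z : α × β | z.2 ∈ B z.1} := by
    have : {z : α × β | z.2 ∈ B z.1} = ⋃ s, {s} ×ˢ B s := by
      ext ⟨s, y⟩
      simp
    rw [this]
    exact .iUnion fun s => (measurableSet_singleton s).prod (hB s)
  have h1 : P {ω | Y ω ∈ B (S ω)} = ((P.map S).prod (P.map Y)) {z : α × β | z.2 ∈ B z.1} := by
    rw [← (indepFun_iff_map_prod_eq_prod_map_map hS hY).1 hSY,
      Measure.map_apply_of_aemeasurable (hS.prodMk hY) hD]
    rfl
  have hc0 : 0 ≤ c := by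
    obtain ⟨s⟩ : Nonempty α := (nonempty_of_isProbabilityMeasure (P.map S))
    exact measureReal_nonneg.trans (hc s)
  refine ENNReal.toReal_le_of_le_ofReal hc0 ?_
  rw [h1, Measure.prod_apply hD]
  calc ∫⁻ s, (P.map Y) (Prod.mk s ⁻¹' {z : α × β | z.2 ∈ B z.1}) ∂(P.map S)
      ≤ ∫⁻ _s, ENNReal.ofReal c ∂(P.map S) := by
        refine lintegral_mono fun s => ?_
        rw [← ofReal_measureReal]
        exact ENNReal.ofReal_le_ofReal (hc s)
    _ = ENNReal.ofReal c := by simp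

end MOM

/-! ### Conclusion -/

theorem mainTheorem2 :
    ∃ C : ℕ, 0 < C ∧
      ∀ (d N K : ℕ) (_hK : 1 ≤ K) (_hKN : K ≤ N)
        -- an arbitrary norm on `ℝ^d`
        (p : Seminorm ℝ (MOM.Vec d)) (_hp : ∀ x, p x = 0 → x = 0)
        -- i.i.d. vectors `Y_i` with law `ν`, having a finite second moment
        (Ω : Type*) (_ : MeasurableSpace Ω) (P : Measure Ω) (_ : IsProbabilityMeasure P)
        (ν : Measure (MOM.Vec d)) (_hν : MemLp id 2 ν)
        (Y : Fin N → Ω → MOM.Vec d) (_hlaw : ∀ i, HasLaw (Y i) ν P) (_hindep : iIndepFun Y P)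
        -- a random split into blocks, independent of the uncorrupted data
        (S : Ω → MOM.BlockSplit N K) (_hS : Measurable S) (_hSY : IndepFun S (fun ω i => Y i ω) P)
        -- the corrupted data `X_i` and the random set `O` of outliers, otherwise arbitrary
        (X : Fin N → Ω → MOM.Vec d) (O : Ω → Finset (Fin N))
        (_hX : ∀ᵐ ω ∂P, ∀ i, i ∉ O ω → X i ω = Y i ω)
        (_hC : ∀ᵐ ω ∂P,
          (C : ℕ∞) * max (MOM.vcDimVec (MOM.dualExtreme p)) ((O ω).card : ℕ∞) ≤ (K : ℕ∞))
        -- any version of the min-max estimator computed from the corrupted data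
        (muHat : Ω → MOM.Vec d)
        (_hmu : ∀ ω, MOM.IsMomEstimate p (S ω) (fun i => X i ω) (muHat ω)),
        ∃ A : Set Ω, MeasurableSet A ∧ 1 - Real.exp (-(K : ℝ) / 128) ≤ P.real A ∧
          ∀ ω ∈ A, p (muHat ω - MOM.mean ν) ≤
            8 * MOM.tripleNorm p (MOM.sqrtCov ν) * Real.sqrt ((K : ℝ) / (N : ℝ)) := by
  refine ⟨16384, by norm_num, ?_⟩
  intro d N K hK hKN p hp Ω _ P _ ν hν Y hlaw hindep S hS hSY X O hX hC muHat hmu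
  have hνp : IsProbabilityMeasure ν :=
    (hlaw ⟨0, by omega⟩).isProbabilityMeasure_iff.1 inferInstance
  set s := MOM.tripleNorm p (MOM.sqrtCov ν) with hs
  have hs0 : 0 ≤ s := MOM.tripleNorm_nonneg _ _
  -- In dimension 0 the bound `1 ≤ V` is not available, but the space is a single point.
  rcases Nat.eq_zero_or_pos d with rfl | hd
  · refine ⟨Set.univ, .univ, ?_, fun ω _ => ?_⟩
    · simpa using (Real.exp_pos (-(K : ℝ) / 128)).le
    · rw [Subsingleton.elim (muHat ω - MOM.mean ν) 0, map_zero]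
      positivity
  -- The VC-dimension is finite because `K` bounds it.
  obtain ⟨V, hV⟩ : ∃ V : ℕ, MOM.vcDimVec (MOM.dualExtreme p) = V := by
    obtain ⟨ω, hω⟩ := hC.exists
    have h1 : MOM.vcDimVec (MOM.dualExtreme p) ≤ K := by
      refine le_trans ?_ ((mul_le_mul_right (le_max_left _ ((O ω).card : ℕ∞)) _).trans hω)
      exact le_mul_of_one_le_left zero_le (by norm_num)
    obtain ⟨V, hV, -⟩ := ENat.le_natCast_iff.1 h1
    exact ⟨V, hV⟩
  have hcard : ∀ᵐ ω ∂P, 16384 * V ≤ K ∧ 16384 * (O ω).card ≤ K := by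
    filter_upwards [hC] with ω hω
    rw [hV] at hω
    have h1 := (mul_le_mul_right (le_max_left (V : ℕ∞) ((O ω).card : ℕ∞)) _).trans hω
    have h2 := (mul_le_mul_right (le_max_right (V : ℕ∞) ((O ω).card : ℕ∞)) _).trans hω
    exact ⟨by exact_mod_cast h1, by exact_mod_cast h2⟩
  have hVK : 16384 * V ≤ K := hcard.exists.choose_spec.1
  have hV1 : 1 ≤ V := by
    have := MOM.one_le_vcDimVec_dualExtreme hd hp
    rw [hV] at this
    exact_mod_cast this
  obtain ⟨D, hDsub, hDc, hDd⟩ := (TopologicalSpace.IsSeparable.of_separableSpace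
    (MOM.dualExtreme p)).exists_countable_dense_subset
  set r := 4 * s * √((K : ℝ) / N) with hr
  have hr0 : 0 ≤ r := by positivity
  let B : MOM.BlockSplit N K → Set (Fin N → MOM.Vec d) := fun T => {y | ∃ u ∈ D,
    7 * (K : ℝ) / 16 ≤ MOM.exceed r u fun k => MOM.blockMean T y k - MOM.mean ν}
  have hBm : ∀ T, MeasurableSet (B T) := by
    intro T
    have : B T = ⋃ u ∈ D, {y | 7 * (K : ℝ) / 16 ≤
        MOM.exceed r u fun k => MOM.blockMean T y k - MOM.mean ν} := by
      ext; simp [B]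
    rw [this]
    exact .biUnion hDc fun u _ =>
      measurableSet_le measurable_const (MOM.measurable_exceed_blockMean T r u _)
  have hYm : ∀ i, AEMeasurable (Y i) P := fun i => (hlaw i).aemeasurable
  have hmap : P.map (fun ω i => Y i ω) = Measure.pi fun _ => ν := by
    rw [(iIndepFun_iff_map_fun_eq_pi_map hYm).1 hindep]
    simp_rw [fun i => (hlaw i).map_eq]
  have hsing : MeasurableSingletonClass (MOM.BlockSplit N K) := ⟨fun _ => trivial⟩
  have hbad : P.real {ω | (fun i => Y i ω) ∈ B (S ω)} ≤ Real.exp (-(K : ℝ) / 128) := by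
    refine MOM.measureReal_mem_le_of_indepFun hS.aemeasurable (aemeasurable_pi_lambda _ hYm)
      hSY B hBm fun T => ?_
    rw [hmap]
    exact MOM.measureReal_exists_exceed_blockMean_le hK hKN hp hν T hDc hDsub hV.le hV1 hVK
  set good : Set Ω := {ω | (∀ i, i ∉ O ω → X i ω = Y i ω) ∧ 16384 * (O ω).card ≤ K} with hgood
  have hgood0 : P goodᶜ = 0 := by
    have : ∀ᵐ ω ∂P, ω ∈ good := by
      filter_upwards [hX, hcard] with ω h1 h2 using ⟨h1, h2.2⟩
    exact this
  set E : Set Ω := {ω | (fun i => Y i ω) ∈ B (S ω)} ∪ goodᶜ with hE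
  -- Neither `X` nor `O` is assumed measurable, so `E` is replaced by a measurable superset of the
  -- same measure.
  refine ⟨(toMeasurable P E)ᶜ, (measurableSet_toMeasurable P E).compl, ?_, fun ω hω => ?_⟩
  · have hPE : P.real (toMeasurable P E) ≤ Real.exp (-(K : ℝ) / 128) := by
      rw [measureReal_def, measure_toMeasurable, ← measureReal_def]
      refine (measureReal_union_le _ _).trans ?_
      rw [measureReal_def P goodᶜ, hgood0]
      simpa using hbad
    rw [measureReal_compl (measurableSet_toMeasurable P E)]
    simp only [probReal_univ]
    linarith
  · have hωE : ω ∉ E := fun h => hω (subset_toMeasurable P E h)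
    simp only [hE, Set.mem_union, Set.mem_compl_iff, not_or, not_not] at hωE
    obtain ⟨hωB, hωX, hωO⟩ := hωE
    have hfin := MOM.seminorm_sub_le_of_exceed hp (S ω) (fun i => X i ω) (hmu ω)
      (μ := MOM.mean ν) hr0 fun u hu => ?_
    · refine hfin.trans (le_of_eq ?_)
      rw [hr]; ring
    · have h1 := MOM.exceed_blockMean_le (S ω) hωX r u (MOM.mean ν)
      have h2 : (MOM.exceed r u (fun k => MOM.blockMean (S ω) (fun i => Y i ω) k -
          MOM.mean ν) : ℝ) < 7 * K / 16 := by
        by_contra! h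
        exact hωB (MOM.exists_exceed_of_subset_closure hDd ⟨u, hu, h⟩)
      have h3 : 16 * MOM.exceed r u (fun k => MOM.blockMean (S ω) (fun i => Y i ω) k -
          MOM.mean ν) < 7 * K := by
        have : (16 : ℝ) * MOM.exceed r u (fun k => MOM.blockMean (S ω) (fun i => Y i ω) k -
          MOM.mean ν) < 7 * K := by linarith
        exact_mod_cast this
      -- Twice the count plus one is less than `7K/8 + K/8192 + 1`, which is below `K` since `K ≥
      -- 16384`.
      omega
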